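/- Let $T$ be a set, whose elements are called types. A multi-virtual link diagram (of type $T$) is a planar drawing of an unoriented link in which every crossing is either classical (with over/under information) or virtual, each virtual crossing being assigned a type from $T$; a multi-virtual $m,n$-tangle is the analogous drawing in a box with $m$ end points at the top and $n$ end points at the bottom. Diagrams are taken in general position with respect to the height function, that is, cut into finitely many horizontal strips containing one maximum, one minimum or one crossing (besides vertical strands) each; planar isotopy is the relation generated by exchanging the heights of neighbouring pieces, cancelling a maximum against an adjacent minimum on the same strand (zigzag), and rotating a crossing by a quarter turn. A multi-virtual detour move takes a strand $s$ that meets the $m$ upper strands of a multi-virtual $m,n$-tangle ($m,n\ge 0$) in virtual crossings that all have one type $\alpha\in T$, and moves it across the tangle, so that it meets the $n$ lower strands of the tangle in virtual crossings of the same type $\alpha$; the end points of $s$, the tangle and the rest of the diagram are unchanged, and loops (curls) with one virtual crossing of type $\alpha$ may be added to and removed from $s$ freely. For types $\alpha,\beta\in T$, consider the following local moves. - $v1$: a loop with one virtual crossing of type $\alpha$ is added or removed. - $v2$: two consecutive virtual crossings, both of type $\alpha$, between two strands bounding a bigon are added or removed. - $cv3$: a strand that meets two strands in two consecutive virtual crossings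 of type $\alpha$ is moved across a classical crossing of these two strands (only one of the two classical crossings that are mirror images of each other is used in the picture of the move, and it does not matter which one). - $mv3$: a strand that meets two strands in two consecutive virtual crossings of type $\alpha$ is moved across a virtual crossing of type $\beta$ of these two strands ($\beta=\alpha$ is allowed). Two diagrams are called equivalent if one is obtained from the other by finitely many applications of isotopy, classical Reidemeister moves and multi-virtual detour moves. **Theorem.** (i) The multi-virtual detour moves are equivalent to the moves $v1$, $v2$, $cv3$, $mv3$: two multi-virtual link diagrams are related by finitely many isotopies and multi-virtual detour moves if and only if they are related by finitely many isotopies and moves $v1$, $v2$, $cv3$, $mv3$ (and their inverses). (ii) Two multi-virtual link diagrams are equivalent if and only if one is obtained from the other by finitely many applications of isotopy, the classical Reidemeister moves, and the moves $v1$, $v2$, $cv3$, $mv3$ (and their inverses). -/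

import Mathlib

namespace MultiVirtual

/-- The elementary pieces of a tangle diagram that is cut into horizontal strips, read from top to
bottom. `T` is the set of types of virtual crossings. -/
inductive Piece (T : Type*) where
  /-- `∩`, a local maximum: no strand above it, two strands below it -/
  | cap : Piece T
  /-- `∪`, a local minimum: two strands above it, no strand below it -/
  | cup : Piece T
  /-- a classical crossing; for `o = true` the strand from top left to bottom right is the
  overpass, for `o = false` the strand from top right to bottom left is -/
  | classical (o : Bool) : Piece T
  /-- a virtual crossing of type `α` -/
  | virt (α : T) : Piece T

namespace Piece

variable {T : Type*}

/-- Number of strands at the top of a piece. -/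
def top : Piece T → ℕ
  | cap => 0
  | cup => 2
  | classical _ => 2
  | virt _ => 2

/-- Number of strands at the bottom of a piece. -/
def bot : Piece T → ℕ
  | cap => 2
  | cup => 0
  | classical _ => 2
  | virt _ => 2

end Piece

/-- A horizontal strip: one elementary piece with `pos` vertical strands on its left and some
number of vertical strands on its right. -/
structure Strip (T : Type*) where
  pos : ℕ
  piece : Piece T

/-- A sequence of strips, from top to bottom. -/
abbrev Strips (T : Type*) := List (Strip T)

/-- Place `p` further vertical strands on the left. (Vertical strands on the right do not change
the sequence of strips.) -/
def shift {T : Type*} (p : ℕ) (w : Strips T) : Strips T :=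
  w.map fun s => ⟨p + s.pos, s.piece⟩

/-- `IsTangle m w n`: the strips `w` fit together to a multi-virtual `m,n`-tangle diagram, with
`m` end points at the top and `n` end points at the bottom. -/
inductive IsTangle {T : Type*} : ℕ → Strips T → ℕ → Prop
  | nil (n : ℕ) : IsTangle n [] n
  | cons (p q : ℕ) (g : Piece T) {w : Strips T} {n : ℕ} (h : IsTangle (p + g.bot + q) w n) :
      IsTangle (p + g.top + q) (⟨p, g⟩ :: w) n

/-- A multi-virtual link diagram of type `T` in the plane, in general position with respect to the
height function: a tangle diagram without end points. Planar isotopy is a relation between such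
diagrams, see `Isotopy`. -/
structure Diagram (T : Type*) where
  strips : Strips T
  closed : IsTangle 0 strips 0

/-- A family of local moves: `R a b l r` says that the `a,b`-tangle diagram `l` may be replaced by
the `a,b`-tangle diagram `r` (with the same end points). -/
abbrev Moves (T : Type*) := ℕ → ℕ → Strips T → Strips T → Prop

/-- `D'` arises from `D` by one application of a move of the family `R`, inside a box with `p`
strands on its left and `q` strands on its right, while the rest of the diagram is unchanged. -/
def Step {T : Type*} (R : Moves T) (D D' : Diagram T) : Prop :=
  ∃ (a b p q : ℕ) (u l r v : Strips T), R a b l r ∧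
    IsTangle 0 u (p + a + q) ∧ IsTangle (p + b + q) v 0 ∧
    D.strips = u ++ shift p l ++ v ∧ D'.strips = u ++ shift p r ++ v

/-- `D` and `D'` are related by finitely many applications of moves of the family `R` and of their
inverses. -/
def Related {T : Type*} (R : Moves T) : Diagram T → Diagram T → Prop :=
  Relation.EqvGen (Step R)

/-- Planar isotopy of diagrams in general position with respect to the height function. -/
inductive Isotopy {T : Type*} : Moves T
  /-- Two pieces `g` and `h`, next to each other with `k` strands between them, may exchange their
  heights. -/
  | exchange (g h : Piece T) (k : ℕ) :
      Isotopy (g.top + k + h.top) (g.bot + k + h.bot)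
        [⟨0, g⟩, ⟨g.bot + k, h⟩] [⟨g.top + k, h⟩, ⟨0, g⟩]
  /-- A maximum and a minimum that follow each other on a strand cancel: `∩` on the left. -/
  | zigzag_left : Isotopy 1 1 [⟨0, .cap⟩, ⟨1, .cup⟩] []
  /-- A maximum and a minimum that follow each other on a strand cancel: `∩` on the right. -/
  | zigzag_right : Isotopy 1 1 [⟨1, .cap⟩, ⟨0, .cup⟩] []
  /-- A classical crossing may be rotated by a quarter turn, in either direction. -/
  | rotate_classical_left (o : Bool) :
      Isotopy 2 2 [⟨0, .cap⟩, ⟨1, .classical o⟩, ⟨2, .cup⟩] [⟨0, .classical (!o)⟩]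
  | rotate_classical_right (o : Bool) :
      Isotopy 2 2 [⟨2, .cap⟩, ⟨1, .classical o⟩, ⟨0, .cup⟩] [⟨0, .classical (!o)⟩]
  /-- A virtual crossing may be rotated by a quarter turn, in either direction. -/
  | rotate_virt_left (α : T) :
      Isotopy 2 2 [⟨0, .cap⟩, ⟨1, .virt α⟩, ⟨2, .cup⟩] [⟨0, .virt α⟩]
  | rotate_virt_right (α : T) :
      Isotopy 2 2 [⟨2, .cap⟩, ⟨1, .virt α⟩, ⟨0, .cup⟩] [⟨0, .virt α⟩]

/-- The classical Reidemeister moves. -/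
inductive Reidemeister {T : Type*} : Moves T
  | r1 (o : Bool) : Reidemeister 1 1 [⟨1, .cap⟩, ⟨0, .classical o⟩, ⟨1, .cup⟩] []
  | r2 (o : Bool) : Reidemeister 2 2 [⟨0, .classical o⟩, ⟨0, .classical (!o)⟩] []
  /-- The three strands, numbered from left to right at the top, cross each other pairwise; `x`,
  `y`, `z` say whether strand 1 is over strand 2, strand 1 over strand 3, strand 2 over strand 3.
  The hypothesis says that the strands can be layered, one above the other. -/
  | r3 (x y z : Bool) (hxyz : x = z → y = x) :
      Reidemeister 3 3 [⟨0, .classical x⟩, ⟨1, .classical y⟩, ⟨0, .classical z⟩]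
        [⟨1, .classical z⟩, ⟨0, .classical y⟩, ⟨1, .classical x⟩]

/-- `AlphaStrand α m w`: in the diagram `w` a strand `s` runs from the top left, across `m` vertical
strands, to the bottom right. It meets each of them in one virtual crossing of type `α`, and it
may have any number of loops of type `α` before, between and after these crossings, on either
side. -/
inductive AlphaStrand {T : Type*} (α : T) : ℕ → Strips T → Prop
  | nil : AlphaStrand α 0 []
  | cross {m : ℕ} {w : Strips T} (h : AlphaStrand α m w) :
      AlphaStrand α (m + 1) (w ++ [⟨m, .virt α⟩])
  | loop_right {m : ℕ} {w : Strips T} (h : AlphaStrand α m w) :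
      AlphaStrand α m (w ++ [⟨m + 1, .cap⟩, ⟨m, .virt α⟩, ⟨m + 1, .cup⟩])
  | loop_left {m : ℕ} {w : Strips T} (h : AlphaStrand α m w) :
      AlphaStrand α m (w ++ [⟨m, .cap⟩, ⟨m + 1, .virt α⟩, ⟨m, .cup⟩])

/-- The multi-virtual detour moves: a strand `s` that meets the `m` upper strands of an
`m,n`-tangle `t` in virtual crossings of one type `α` is moved across `t`, so that it meets the `n`
lower strands of `t` in virtual crossings of type `α`; loops of type `α` on `s` are freely added
and removed. On the left-hand side `s` passes above `t` (and ends on its right), on the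
right-hand side it passes below `t` (and starts on its left). -/
inductive Detour {T : Type*} : Moves T
  | mk (α : T) (m n : ℕ) (t s s' : Strips T) (ht : IsTangle m t n)
      (hs : AlphaStrand α m s) (hs' : AlphaStrand α n s') :
      Detour (m + 1) (n + 1) (s ++ t) (shift 1 t ++ s')

/-- `v1`: a loop with one virtual crossing is removed. -/
inductive V1 {T : Type*} : Moves T
  | mk (α : T) : V1 1 1 [⟨1, .cap⟩, ⟨0, .virt α⟩, ⟨1, .cup⟩] []

/-- `v2`: two consecutive virtual crossings, of the same type, of two strands are removed. -/
inductive V2 {T : Type*} : Moves T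
  | mk (α : T) : V2 2 2 [⟨0, .virt α⟩, ⟨0, .virt α⟩] []

/-- `cv3`: a strand with two consecutive virtual crossings of the same type is moved across a
classical crossing. The parameter `o` is the classical crossing in the picture of the move: only
one of the two classical crossings is used. -/
inductive CV3 {T : Type*} (o : Bool) : Moves T
  | mk (α : T) : CV3 o 3 3 [⟨0, .virt α⟩, ⟨1, .virt α⟩, ⟨0, .classical o⟩]
      [⟨1, .classical o⟩, ⟨0, .virt α⟩, ⟨1, .virt α⟩]

/-- `mv3`: a strand with two consecutive virtual crossings of the same type `α` is moved across a
virtual crossing of any type `β`. -/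
inductive MV3 {T : Type*} : Moves T
  | mk (α β : T) : MV3 3 3 [⟨0, .virt α⟩, ⟨1, .virt α⟩, ⟨0, .virt β⟩]
      [⟨1, .virt β⟩, ⟨0, .virt α⟩, ⟨1, .virt α⟩]

/-- Equivalence of multi-virtual link diagrams: isotopy, classical Reidemeister moves and
multi-virtual detour moves. -/
def Equivalent {T : Type*} : Diagram T → Diagram T → Prop :=
  Related (Isotopy ⊔ Reidemeister ⊔ Detour)

end MultiVirtual

/-! The detour moves reduce to local ones because a strand can cross a tangle one elementary piece
at a time. Using v1, the loops of the moving strand are removed, leaving a plain `row` of crossings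
of type `α`. By induction on the strips (`Derivable.slide`) it suffices to pass this row over one
piece (`Slides`). A virtual crossing is mv3 and the chosen classical crossing is cv3. For an
extremum, isotopy carries one crossing around it and v2 removes the resulting pair. The opposite
classical crossing is a quarter turn of the chosen one, hence a tangle of pieces already treated.
Conversely, v1, cv3 and mv3 are detours across an empty tangle or a single crossing; v2 comes from a
detour across a minimum (`V2.derivable`). Both parts of the theorem then follow by replacing moves
through `Related.of_derivable`. -/

namespace MultiVirtual

variable {T : Type*}

/-! ### Composition and placement of tangle diagrams -/

@[simp] theorem shift_nil (p : ℕ) : shift p ([] : Strips T) = [] := rfl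

@[simp] theorem shift_cons (p : ℕ) (s : Strip T) (w : Strips T) :
    shift p (s :: w) = ⟨p + s.pos, s.piece⟩ :: shift p w := rfl

@[simp] theorem shift_append (p : ℕ) (w z : Strips T) :
    shift p (w ++ z) = shift p w ++ shift p z := List.map_append

theorem shift_shift (p q : ℕ) (w : Strips T) : shift p (shift q w) = shift (p + q) w := by
  simp [shift, Nat.add_assoc]

theorem IsTangle.cons_of_le {k p : ℕ} {g : Piece T} {w : Strips T} {n : ℕ} (hp : p + g.top ≤ k)
    (h : IsTangle (k - g.top + g.bot) w n) : IsTangle k (⟨p, g⟩ :: w) n := by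
  obtain ⟨q, rfl⟩ := Nat.exists_eq_add_of_le hp
  refine .cons p q g ?_
  convert h using 1
  omega

theorem IsTangle.append {a b c : ℕ} {w z : Strips T} (hw : IsTangle a w b) (hz : IsTangle b z c) :
    IsTangle a (w ++ z) c := by
  induction hw with
  | nil => exact hz
  | cons p q g _ ih => exact .cons p q g (ih hz)

theorem IsTangle.shift {a b : ℕ} {w : Strips T} (hw : IsTangle a w b) (p q : ℕ) :
    IsTangle (p + a + q) (shift p w) (p + b + q) := by
  induction hw with
  | nil n => exact .nil _
  | cons p' q' g _ ih =>
    rw [shift_cons]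
    refine .cons_of_le (by dsimp only; omega) ?_
    dsimp only
    convert ih using 1
    omega

theorem IsTangle.single (p q : ℕ) (g : Piece T) :
    IsTangle (p + g.top + q) [⟨p, g⟩] (p + g.bot + q) :=
  .cons p q g (.nil _)

/-- The number of strands below `w`, if `w` has `k` strands above it, and `none` if `w` does not
fit below `k` strands. -/
def bottom : ℕ → Strips T → Option ℕ
  | k, [] => some k
  | k, s :: w =>
    if s.pos + s.piece.top ≤ k then bottom (k - s.piece.top + s.piece.bot) w else none

/-- Reduces the fit of an explicit diagram to a computation, so that `rfl` settles it. -/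
theorem IsTangle.of_bottom {k n : ℕ} {w : Strips T} (h : bottom k w = some n) :
    IsTangle k w n := by
  induction w generalizing k with
  | nil =>
    cases h
    exact .nil _
  | cons s w ih =>
    rw [bottom] at h
    split at h
    · exact .cons_of_le ‹_› (ih h)
    · cases h

/-! ### Local replacement as a congruence on tangles -/

/-- The `a,b`-tangle diagrams `l` and `r` may replace each other in every diagram, by means of
moves of the family `S` and their inverses. -/
structure Derivable (S : Moves T) (a b : ℕ) (l r : Strips T) : Prop where
  left : IsTangle a l b
  right : IsTangle a r b
  related : ∀ (p q : ℕ) (u v : Strips T) (D D' : Diagram T),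
    IsTangle 0 u (p + a + q) → IsTangle (p + b + q) v 0 →
    D.strips = u ++ MultiVirtual.shift p l ++ v → D'.strips = u ++ MultiVirtual.shift p r ++ v →
    Related S D D'

namespace Derivable

variable {S : Moves T} {a b c d : ℕ} {l r m : Strips T}

theorem refl (h : IsTangle a l b) : Derivable S a b l l :=
  ⟨h, h, fun _ _ _ _ D D' _ _ hD hD' => by
    obtain ⟨_, _⟩ := D
    obtain ⟨_, _⟩ := D'
    cases hD.trans hD'.symm
    exact .refl _⟩

theorem symm (h : Derivable S a b l r) : Derivable S a b r l :=
  ⟨h.right, h.left, fun p q u v D D' hu hv hD hD' =>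
    .symm _ _ (h.related p q u v D' D hu hv hD' hD)⟩

theorem trans (h : Derivable S a b l m) (h' : Derivable S a b m r) : Derivable S a b l r :=
  ⟨h.left, h'.right, fun p q u v D D' hu hv hD hD' =>
    let E : Diagram T := ⟨u ++ MultiVirtual.shift p m ++ v, (hu.append (h.right.shift p q)).append hv⟩
    .trans _ E _ (h.related p q u v D E hu hv hD rfl) (h'.related p q u v E D' hu hv rfl hD')⟩

theorem of_move (hl : IsTangle a l b) (hr : IsTangle a r b) (h : S a b l r) :
    Derivable S a b l r :=
  ⟨hl, hr, fun p q u v _ _ hu hv hD hD' => .rel _ _ ⟨a, b, p, q, u, l, r, v, h, hu, hv, hD, hD'⟩⟩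

/-- A context inside a context is again a context: the offsets add up, and the outer strips absorb
the inner ones. -/
theorem context (h : Derivable S a b l r) {p q : ℕ} {u v : Strips T}
    (hu : IsTangle c u (p + a + q)) (hv : IsTangle (p + b + q) v d) :
    Derivable S c d (u ++ MultiVirtual.shift p l ++ v) (u ++ MultiVirtual.shift p r ++ v) :=
  ⟨(hu.append (h.left.shift p q)).append hv, (hu.append (h.right.shift p q)).append hv,
    fun p' q' u' v' D D' hu' hv' hD hD' => by
      refine h.related (p' + p) (q + q') (u' ++ MultiVirtual.shift p' u)
        (MultiVirtual.shift p' v ++ v') D D' ?_ ?_ ?_ ?_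
      · convert hu'.append (hu.shift p' q') using 1
        omega
      · convert (hv.shift p' q').append hv' using 1
        omega
      · simp [hD, shift_shift]
      · simp [hD', shift_shift]⟩

theorem cast {a' b' : ℕ} {l' r' : Strips T} (h : Derivable S a b l r) (ha : a = a') (hb : b = b')
    (hl : l = l') (hr : r = r') : Derivable S a' b' l' r' := by
  subst ha hb hl hr
  exact h

/-- A version of `Derivable.context` for explicit diagrams. -/
theorem rewrite (p q : ℕ) (u v : Strips T) (h : Derivable S a b l r) {w w' : Strips T}
    (hu : IsTangle c u (p + a + q)) (hv : IsTangle (p + b + q) v d)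
    (hw : w = u ++ MultiVirtual.shift p l ++ v) (hw' : w' = u ++ MultiVirtual.shift p r ++ v) :
    Derivable S c d w w' :=
  (h.context hu hv).cast rfl rfl hw.symm hw'.symm

theorem append_left (h : Derivable S a b l r) (hu : IsTangle c m a) :
    Derivable S c b (m ++ l) (m ++ r) :=
  h.rewrite 0 0 m [] (by simpa using hu) (by simpa using IsTangle.nil b)
    (by simp [MultiVirtual.shift]) (by simp [MultiVirtual.shift])

theorem append_right (h : Derivable S a b l r) (hv : IsTangle b m c) :
    Derivable S a c (l ++ m) (r ++ m) :=
  h.rewrite 0 0 [] m (by simpa using IsTangle.nil a) (by simpa using hv)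
    (by simp [MultiVirtual.shift]) (by simp [MultiVirtual.shift])

theorem shift (h : Derivable S a b l r) (p q : ℕ) :
    Derivable S (p + a + q) (p + b + q) (MultiVirtual.shift p l) (MultiVirtual.shift p r) :=
  h.rewrite p q [] [] (.nil _) (.nil _) (by simp) (by simp)

end Derivable

/-- If the moves of `R` can be derived from those of `S`, then `R`-related diagrams are
`S`-related. -/
theorem Related.of_derivable {R S : Moves T}
    (h : ∀ a b l r, R a b l r → Derivable S a b l r) {D D' : Diagram T} (hD : Related R D D') :
    Related S D D' := by
  induction hD with
  | rel D D' hD =>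
    obtain ⟨a, b, p, q, u, l, r, v, hR, hu, hv, h1, h2⟩ := hD
    exact (h a b l r hR).related p q u v D D' hu hv h1 h2
  | refl => exact .refl _
  | symm _ _ _ ih => exact .symm _ _ ih
  | trans _ _ _ _ _ ih ih' => exact .trans _ _ _ ih ih'

/-! ### Height exchange of whole tangles -/

section Isotopy

variable {S : Moves T}

theorem Isotopy.isTangle {a b : ℕ} {l r : Strips T} (h : Isotopy a b l r) :
    IsTangle a l b ∧ IsTangle a r b := by
  cases h with
  | exchange g h k =>
    constructor
    · refine .cons_of_le (by simp; omega) (.cons_of_le (by omega) ?_)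
      convert IsTangle.nil _ using 1
      omega
    · refine .cons_of_le (by omega) (.cons_of_le (by omega) ?_)
      convert IsTangle.nil _ using 1
      omega
  | _ => exact ⟨.of_bottom rfl, .of_bottom rfl⟩

theorem Reidemeister.isTangle {a b : ℕ} {l r : Strips T} (h : Reidemeister a b l r) :
    IsTangle a l b ∧ IsTangle a r b := by
  cases h <;> exact ⟨.of_bottom rfl, .of_bottom rfl⟩

theorem Derivable.of_isotopy (hI : Isotopy ≤ S) {a b : ℕ} {l r : Strips T} (h : Isotopy a b l r) :
    Derivable S a b l r :=
  .of_move h.isTangle.1 h.isTangle.2 (hI _ _ _ _ h)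

/-- The piece `g`, lying to the right of `w`, rises past the strips of `w` one by one, from the
lowest to the highest. -/
theorem Derivable.exchange_piece (hI : Isotopy ≤ S) {a b : ℕ} {w : Strips T} (hw : IsTangle a w b)
    (p q : ℕ) (g : Piece T) :
    Derivable S (a + (p + g.top + q)) (b + (p + g.bot + q))
      (w ++ [⟨b + p, g⟩]) (⟨a + p, g⟩ :: w) := by
  induction hw with
  | nil n =>
    refine .refl (.cons_of_le (by omega) ?_)
    convert IsTangle.nil _ using 1
    omega
  | @cons p' q' f w n hw ih =>
    have h1 := Derivable.append_left (m := [⟨p', f⟩]) (c := p' + f.top + q' + (p + g.top + q)) ih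
      (by
        convert IsTangle.single p' (q' + (p + g.top + q)) f using 1 <;> omega)
    have h2 := Derivable.of_isotopy hI (Isotopy.exchange f g (q' + p))
    refine (h1.cast rfl rfl (by simp) rfl).trans ?_
    refine h2.rewrite p' q [] w ?_ ?_ ?_ ?_
    · convert IsTangle.nil _ using 1
      omega
    · convert hw.shift 0 (p + g.bot + q) using 1
      · omega
      · simp [MultiVirtual.shift]
      · omega
    · simp; omega
    · simp; omega

theorem Derivable.exchange (hI : Isotopy ≤ S) {a b c d : ℕ} {w z : Strips T}
    (hw : IsTangle a w b) (hz : IsTangle c z d) :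
    Derivable S (a + c) (b + d) (w ++ MultiVirtual.shift b z) (MultiVirtual.shift a z ++ w) := by
  induction hz with
  | nil n =>
    simpa using Derivable.refl (by simpa [MultiVirtual.shift] using hw.shift 0 n)
  | @cons p q g z n hz ih =>
    have h1 := (Derivable.exchange_piece hI hw p q g).append_right
      (by simpa using hz.shift b 0)
    have h2 := ih.append_left (m := [⟨a + p, g⟩]) (c := a + (p + g.top + q))
      (by convert IsTangle.single (a + p) q g using 1 <;> omega)
    exact (h1.cast rfl rfl (by simp) (by simp)).trans h2

end Isotopy

/-- A strand that runs from the top left, across `m` vertical strands, to the bottom right, and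
meets each of them in one virtual crossing of type `α`. -/
def row (α : T) (m : ℕ) : Strips T := (List.range m).map fun i => ⟨i, .virt α⟩

theorem row_succ (α : T) (m : ℕ) : row α (m + 1) = row α m ++ [⟨m, .virt α⟩] := by
  simp [row, List.range_succ]

theorem row_add (α : T) (m n : ℕ) : row α (m + n) = row α m ++ shift m (row α n) := by
  simp [row, List.range_add, shift]

theorem isTangle_row (α : T) (m : ℕ) : IsTangle (m + 1) (row α m) (m + 1) := by
  induction m with
  | zero => exact .nil _
  | succ m ih =>
    rw [row_succ]
    exact IsTangle.append (b := m + 1 + 1) (by simpa [shift] using ih.shift 0 1)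
      (.single m 0 (.virt α))

/-! ### Detours from the local moves -/

section Slide

variable {S : Moves T}

/-- The strand `row α` can be moved across the piece `g`. -/
abbrev Slides (S : Moves T) (α : T) (g : Piece T) : Prop :=
  Derivable S (g.top + 1) (g.bot + 1) (row α g.top ++ [⟨0, g⟩]) (⟨1, g⟩ :: row α g.bot)

theorem Slides.strip (hI : Isotopy ≤ S) {α : T} {g : Piece T} (h : Slides S α g) (p q : ℕ) :
    Derivable S (p + g.top + q + 1) (p + g.bot + q + 1)
      (row α (p + g.top + q) ++ [⟨p, g⟩]) (⟨p + 1, g⟩ :: row α (p + g.bot + q)) := by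
  have hp : IsTangle (p + g.top + q + 1) (row α p) (p + g.top + q + 1) := by
    convert (isTangle_row α p).shift 0 (g.top + q) using 1
    · omega
    · simp [shift]
    · omega
  have hq : IsTangle (p + g.bot + q + 1) (shift (p + g.bot) (row α q)) (p + g.bot + q + 1) := by
    simpa [Nat.add_assoc] using (isTangle_row α q).shift (p + g.bot) 0
  have hm : IsTangle (p + g.top + q + 1) (shift p (row α g.top)) (p + g.top + q + 1) := by
    convert (isTangle_row α g.top).shift p q using 1 <;> omega
  -- The row splits into `p` crossings left of `g`, those above `g`, and `q` right of it. The outer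
  -- groups pass `g` by height exchange (`e1`, `e3`); only the middle one needs `h`.
  have e1 := (Derivable.exchange hI (IsTangle.single p 0 g) (isTangle_row α q)).symm.append_left
    (m := row α p ++ shift p (row α g.top)) (c := p + g.top + q + 1)
    (by convert hp.append hm using 1; omega)
  have e2 : Derivable S (p + g.top + q + 1) (p + g.bot + q + 1) _ _ :=
    (h.context (p := p) (q := q) (u := row α p) (v := shift (p + g.bot) (row α q))
      (by convert hp using 1; omega) (by convert hq using 1; omega))
  have e3 := (Derivable.exchange hI (isTangle_row α p) (IsTangle.single 0 q g)).append_right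
    (m := shift p (row α g.bot) ++ shift (p + g.bot) (row α q)) (c := p + g.bot + q + 1)
    (IsTangle.append (b := p + g.bot + q + 1)
      (by convert (isTangle_row α g.bot).shift p q using 1 <;> omega) hq)
  refine ((e1.cast rfl (by omega) (by simp [row_add]) rfl).trans
    (e2.cast rfl rfl (by simp) rfl)).trans (e3.cast (by omega) rfl (by simp) (by simp [row_add]))

theorem Derivable.slide (hI : Isotopy ≤ S) {α : T} {m n : ℕ} {t : Strips T} (ht : IsTangle m t n)
    (h : ∀ s ∈ t, Slides S α s.piece) :
    Derivable S (m + 1) (n + 1) (row α m ++ t) (MultiVirtual.shift 1 t ++ row α n) := by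
  induction ht with
  | nil n => simpa using Derivable.refl (isTangle_row α n)
  | @cons p q g w n hw ih =>
    have h1 := (Slides.strip hI (h ⟨p, g⟩ (by simp)) p q).append_right
      (by simpa [MultiVirtual.shift] using hw.shift 0 1)
    have h2 := (ih fun s hs => h s (by simp [hs])).append_left (m := [⟨p + 1, g⟩])
      (c := p + g.top + q + 1) (by
        refine .cons_of_le (by omega) ?_
        convert IsTangle.nil _ using 1
        omega)
    exact (h1.cast rfl rfl (by simp) (by simp)).trans (h2.cast rfl rfl rfl (by simp [Nat.add_comm]))

/-- A virtual crossing next to a maximum can be passed to the other side of the maximum. -/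
theorem Derivable.cap_virt (hI : Isotopy ≤ S) (α : T) :
    Derivable S 1 3 [⟨1, .cap⟩, ⟨0, .virt α⟩] [⟨0, .cap⟩, ⟨1, .virt α⟩] := by
  have iso {a b : ℕ} {l r : Strips T} (h : Isotopy a b l r) := Derivable.of_isotopy hI h
  -- The quarter turn creates a new maximum and minimum; after height exchanges the minimum cancels
  -- the original maximum, and the new maximum survives.
  have h1 : Derivable S 1 3 [⟨1, .cap⟩, ⟨0, .virt α⟩]
      [⟨1, .cap⟩, ⟨0, .cap⟩, ⟨1, .virt α⟩, ⟨2, .cup⟩] :=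
    (iso (.rotate_virt_left α)).symm.rewrite 0 1 [⟨1, .cap⟩] []
      (.of_bottom rfl) (.of_bottom rfl) rfl rfl
  have h2 : Derivable S 1 3 [⟨1, .cap⟩, ⟨0, .cap⟩, ⟨1, .virt α⟩, ⟨2, .cup⟩]
      [⟨0, .cap⟩, ⟨3, .cap⟩, ⟨1, .virt α⟩, ⟨2, .cup⟩] :=
    (iso (.exchange .cap .cap 1)).symm.rewrite 0 0 [] [⟨1, .virt α⟩, ⟨2, .cup⟩]
      (.of_bottom rfl) (.of_bottom rfl) rfl rfl
  have h3 : Derivable S 1 3 [⟨0, .cap⟩, ⟨3, .cap⟩, ⟨1, .virt α⟩, ⟨2, .cup⟩]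
      [⟨0, .cap⟩, ⟨1, .virt α⟩, ⟨3, .cap⟩, ⟨2, .cup⟩] :=
    (iso (.exchange (.virt α) .cap 0)).symm.rewrite 1 0 [⟨0, .cap⟩] [⟨2, .cup⟩]
      (.of_bottom rfl) (.of_bottom rfl) rfl rfl
  have h4 : Derivable S 1 3 [⟨0, .cap⟩, ⟨1, .virt α⟩, ⟨3, .cap⟩, ⟨2, .cup⟩]
      [⟨0, .cap⟩, ⟨1, .virt α⟩] :=
    (iso .zigzag_right).rewrite 2 0 [⟨0, .cap⟩, ⟨1, .virt α⟩] []
      (.of_bottom rfl) (.of_bottom rfl) rfl rfl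
  exact ((h1.trans h2).trans h3).trans h4

/-- A virtual crossing next to a minimum can be passed to the other side of the minimum. -/
theorem Derivable.virt_cup (hI : Isotopy ≤ S) (α : T) :
    Derivable S 3 1 [⟨0, .virt α⟩, ⟨1, .cup⟩] [⟨1, .virt α⟩, ⟨0, .cup⟩] := by
  have iso {a b : ℕ} {l r : Strips T} (h : Isotopy a b l r) := Derivable.of_isotopy hI h
  have h1 : Derivable S 3 1 [⟨0, .virt α⟩, ⟨1, .cup⟩]
      [⟨2, .cap⟩, ⟨1, .virt α⟩, ⟨0, .cup⟩, ⟨1, .cup⟩] :=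
    (iso (.rotate_virt_right α)).symm.rewrite 0 1 [] [⟨1, .cup⟩]
      (.of_bottom rfl) (.of_bottom rfl) rfl rfl
  have h2 : Derivable S 3 1 [⟨2, .cap⟩, ⟨1, .virt α⟩, ⟨0, .cup⟩, ⟨1, .cup⟩]
      [⟨2, .cap⟩, ⟨1, .virt α⟩, ⟨3, .cup⟩, ⟨0, .cup⟩] :=
    (iso (.exchange .cup .cup 1)).rewrite 0 0 [⟨2, .cap⟩, ⟨1, .virt α⟩] []
      (.of_bottom rfl) (.of_bottom rfl) rfl rfl
  have h3 : Derivable S 3 1 [⟨2, .cap⟩, ⟨1, .virt α⟩, ⟨3, .cup⟩, ⟨0, .cup⟩]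
      [⟨2, .cap⟩, ⟨3, .cup⟩, ⟨1, .virt α⟩, ⟨0, .cup⟩] :=
    (iso (.exchange (.virt α) .cup 0)).rewrite 1 0 [⟨2, .cap⟩] [⟨0, .cup⟩]
      (.of_bottom rfl) (.of_bottom rfl) rfl rfl
  have h4 : Derivable S 3 1 [⟨2, .cap⟩, ⟨3, .cup⟩, ⟨1, .virt α⟩, ⟨0, .cup⟩]
      [⟨1, .virt α⟩, ⟨0, .cup⟩] :=
    (iso .zigzag_left).rewrite 2 0 [] [⟨1, .virt α⟩, ⟨0, .cup⟩]
      (.of_bottom rfl) (.of_bottom rfl) rfl rfl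
  exact ((h1.trans h2).trans h3).trans h4

/-- Carrying the second crossing to the other leg of the minimum puts it directly below the first,
where v2 applies. -/
theorem Slides.cup (hI : Isotopy ≤ S) (h2 : V2 ≤ S) (α : T) : Slides S α .cup :=
  (((Derivable.virt_cup hI α).symm.rewrite 0 0 [⟨0, .virt α⟩] []
      (.of_bottom rfl) (.of_bottom rfl) rfl rfl).trans
    ((Derivable.of_move (.of_bottom rfl) (.of_bottom rfl) (h2 _ _ _ _ (.mk α))).rewrite
      0 1 [] [⟨1, .cup⟩] (.of_bottom rfl) (.of_bottom rfl) rfl rfl) :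
    Derivable S 3 1 [⟨0, .virt α⟩, ⟨1, .virt α⟩, ⟨0, .cup⟩] [⟨1, .cup⟩])

theorem Slides.cap (hI : Isotopy ≤ S) (h2 : V2 ≤ S) (α : T) : Slides S α .cap :=
  (((Derivable.cap_virt hI α).rewrite 0 0 [] [⟨1, .virt α⟩]
      (.of_bottom rfl) (.of_bottom rfl) rfl rfl).trans
    ((Derivable.of_move (.of_bottom rfl) (.of_bottom rfl) (h2 _ _ _ _ (.mk α))).rewrite
      1 0 [⟨0, .cap⟩] [] (.of_bottom rfl) (.of_bottom rfl) rfl rfl) :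
    Derivable S 1 3 [⟨1, .cap⟩, ⟨0, .virt α⟩, ⟨1, .virt α⟩] [⟨0, .cap⟩]).symm

theorem Slides.virt (h3 : MV3 ≤ S) (α β : T) : Slides S α (.virt β) :=
  .of_move (.of_bottom rfl) (.of_bottom rfl) (h3 _ _ _ _ (.mk α β))

theorem Slides.classical_self {o : Bool} (h3 : CV3 o ≤ S) (α : T) : Slides S α (.classical o) :=
  .of_move (.of_bottom rfl) (.of_bottom rfl) (h3 _ _ _ _ (.mk α))

/-- The opposite crossing is replaced by its rotated form, built from a maximum, the crossing `o`
and a minimum, all of which slide; afterwards it is rotated back. -/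
theorem Slides.classical_not (hI : Isotopy ≤ S) (h2 : V2 ≤ S) {o : Bool} (h3 : CV3 o ≤ S)
    (α : T) : Slides S α (.classical !o) := by
  have rot := Derivable.of_isotopy hI (Isotopy.rotate_classical_left o)
  have h := Derivable.slide hI (α := α) rot.left (by
    simp [Slides.cup hI h2, Slides.cap hI h2, Slides.classical_self h3])
  refine (rot.symm.rewrite 0 1 (row α 2) [] (.of_bottom rfl) (.of_bottom rfl) rfl rfl).trans
    (h.trans (rot.rewrite 1 0 [] (row α 2) (.of_bottom rfl) (.of_bottom rfl) rfl rfl))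

theorem Slides.of_moves (hI : Isotopy ≤ S) (h2 : V2 ≤ S) {o : Bool} (hc : CV3 o ≤ S)
    (hm : MV3 ≤ S) (α : T) : ∀ g : Piece T, Slides S α g
  | .cap => .cap hI h2 α
  | .cup => .cup hI h2 α
  | .virt β => .virt hm α β
  | .classical o' => by
    obtain rfl | rfl : o' = o ∨ o' = !o := by cases o <;> cases o' <;> simp
    · exact .classical_self hc α
    · exact .classical_not hI h2 hc α

theorem Derivable.loop_right (h1 : V1 ≤ S) (α : T) :
    Derivable S 1 1 [⟨1, .cap⟩, ⟨0, .virt α⟩, ⟨1, .cup⟩] [] :=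
  .of_move (.of_bottom rfl) (.of_bottom rfl) (h1 _ _ _ _ (.mk α))

/-- A zigzag inserted below the twist turns it, up to isotopy, into a v1 loop on the right leg of
the maximum. -/
theorem Derivable.cap_twist (hI : Isotopy ≤ S) (h1 : V1 ≤ S) (α : T) :
    Derivable S 0 2 [⟨0, .cap⟩, ⟨0, .virt α⟩] [⟨0, .cap⟩] := by
  have iso {a b : ℕ} {l r : Strips T} (h : Isotopy a b l r) := Derivable.of_isotopy hI h
  have e1 : Derivable S 0 2 [⟨0, .cap⟩, ⟨0, .virt α⟩]
      [⟨0, .cap⟩, ⟨0, .virt α⟩, ⟨0, .cap⟩, ⟨1, .cup⟩] :=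
    (iso .zigzag_left).symm.rewrite 0 1 [⟨0, .cap⟩, ⟨0, .virt α⟩] []
      (.of_bottom rfl) (.of_bottom rfl) rfl rfl
  have e2 : Derivable S 0 2 [⟨0, .cap⟩, ⟨0, .virt α⟩, ⟨0, .cap⟩, ⟨1, .cup⟩]
      [⟨0, .cap⟩, ⟨0, .cap⟩, ⟨2, .virt α⟩, ⟨1, .cup⟩] :=
    (iso (.exchange .cap (.virt α) 0)).symm.rewrite 0 0 [⟨0, .cap⟩] [⟨1, .cup⟩]
      (.of_bottom rfl) (.of_bottom rfl) rfl rfl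
  have e3 : Derivable S 0 2 [⟨0, .cap⟩, ⟨0, .cap⟩, ⟨2, .virt α⟩, ⟨1, .cup⟩]
      [⟨0, .cap⟩, ⟨2, .cap⟩, ⟨2, .virt α⟩, ⟨1, .cup⟩] :=
    (iso (.exchange .cap .cap 0)).symm.rewrite 0 0 [] [⟨2, .virt α⟩, ⟨1, .cup⟩]
      (.of_bottom rfl) (.of_bottom rfl) rfl rfl
  have e4 : Derivable S 0 2 [⟨0, .cap⟩, ⟨2, .cap⟩, ⟨2, .virt α⟩, ⟨1, .cup⟩]
      [⟨0, .cap⟩, ⟨2, .cap⟩, ⟨1, .virt α⟩, ⟨2, .cup⟩] :=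
    (Derivable.virt_cup hI α).symm.rewrite 1 0 [⟨0, .cap⟩, ⟨2, .cap⟩] []
      (.of_bottom rfl) (.of_bottom rfl) rfl rfl
  have e5 : Derivable S 0 2 [⟨0, .cap⟩, ⟨2, .cap⟩, ⟨1, .virt α⟩, ⟨2, .cup⟩] [⟨0, .cap⟩] :=
    (Derivable.loop_right h1 α).rewrite 1 0 [⟨0, .cap⟩] []
      (.of_bottom rfl) (.of_bottom rfl) rfl rfl
  exact (((e1.trans e2).trans e3).trans e4).trans e5

/-- v1 provides loops on the right side only; a left loop becomes a twisted maximum once its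
crossing is carried around the minimum. -/
theorem Derivable.loop_left (hI : Isotopy ≤ S) (h1 : V1 ≤ S) (α : T) :
    Derivable S 1 1 [⟨0, .cap⟩, ⟨1, .virt α⟩, ⟨0, .cup⟩] [] := by
  have e1 : Derivable S 1 1 [⟨0, .cap⟩, ⟨1, .virt α⟩, ⟨0, .cup⟩]
      [⟨0, .cap⟩, ⟨0, .virt α⟩, ⟨1, .cup⟩] :=
    (Derivable.virt_cup hI α).symm.rewrite 0 0 [⟨0, .cap⟩] []
      (.of_bottom rfl) (.of_bottom rfl) rfl rfl
  have e2 : Derivable S 1 1 [⟨0, .cap⟩, ⟨0, .virt α⟩, ⟨1, .cup⟩] [⟨0, .cap⟩, ⟨1, .cup⟩] :=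
    (Derivable.cap_twist hI h1 α).rewrite 0 1 [] [⟨1, .cup⟩]
      (.of_bottom rfl) (.of_bottom rfl) rfl rfl
  exact (e1.trans e2).trans (.of_isotopy hI .zigzag_left)

/-- The loops of an `α`-strand can be removed. -/
theorem AlphaStrand.derivable_row (hI : Isotopy ≤ S) (h1 : V1 ≤ S) {α : T} {m : ℕ} {s : Strips T}
    (hs : AlphaStrand α m s) : Derivable S (m + 1) (m + 1) s (row α m) := by
  induction hs with
  | nil => exact .refl (.nil _)
  | @cross m w _ ih =>
    rw [row_succ]
    exact Derivable.append_right (b := m + 1 + 1) (by simpa [MultiVirtual.shift] using ih.shift 0 1)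
      (.single m 0 (.virt α))
  | @loop_right m w _ ih =>
    have h := ((Derivable.loop_right h1 α).shift m 0).append_left ih.left
    exact (h.cast rfl rfl rfl (by simp)).trans ih
  | @loop_left m w _ ih =>
    have h := ((Derivable.loop_left hI h1 α).shift m 0).append_left ih.left
    exact (h.cast rfl rfl rfl (by simp)).trans ih

theorem Detour.derivable (hI : Isotopy ≤ S) {o : Bool} (hV : V1 ⊔ V2 ⊔ CV3 o ⊔ MV3 ≤ S) {a b : ℕ}
    {l r : Strips T} (h : Detour a b l r) : Derivable S a b l r := by
  simp only [sup_le_iff] at hV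
  obtain ⟨⟨⟨h1, h2⟩, hc⟩, hm⟩ := hV
  obtain ⟨α, m, n, t, s, s', ht, hs, hs'⟩ := h
  have e1 := (hs.derivable_row hI h1).append_right
    (show IsTangle (m + 1) t (n + 1) by simpa [shift] using ht.shift 0 1)
  have e2 := Derivable.slide hI (α := α) ht fun s _ => .of_moves hI h2 hc hm α s.piece
  have e3 := (hs'.derivable_row hI h1).append_left
    (show IsTangle (m + 1) (shift 1 t) (n + 1) by simpa [Nat.add_comm] using ht.shift 1 0)
  exact (e1.trans e2).trans e3.symm

end Slide

/-! ### Local moves from detours -/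

section Converse

variable {S : Moves T}

theorem alphaStrand_two (α : T) : AlphaStrand α 2 [⟨0, .virt α⟩, ⟨1, .virt α⟩] :=
  .cross (.cross .nil)

theorem V2.derivable (hI : Isotopy ≤ S) (hD : Detour ≤ S) (α : T) :
    Derivable S 2 2 [⟨0, .virt α⟩, ⟨0, .virt α⟩] [] := by
  have iso {a b : ℕ} {l r : Strips T} (h : Isotopy a b l r) := Derivable.of_isotopy hI h
  -- With `n = 0` the strand leaves the minimum without crossings, so this detour removes two
  -- crossings at once. Rotating the lower crossing of the v2 bigon supplies the minimum.
  have hcup : Derivable S 3 1 [⟨0, .virt α⟩, ⟨1, .virt α⟩, ⟨0, .cup⟩] [⟨1, .cup⟩] :=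
    .of_move (.of_bottom rfl) (.of_bottom rfl) (hD _ _ _ _
      (.mk α 2 0 [⟨0, .cup⟩] _ [] (.of_bottom rfl) (alphaStrand_two α) .nil))
  have e1 : Derivable S 2 2 [⟨0, .virt α⟩, ⟨0, .virt α⟩]
      [⟨0, .virt α⟩, ⟨2, .cap⟩, ⟨1, .virt α⟩, ⟨0, .cup⟩] :=
    (iso (.rotate_virt_right α)).symm.rewrite 0 0 [⟨0, .virt α⟩] []
      (.of_bottom rfl) (.of_bottom rfl) rfl rfl
  have e2 : Derivable S 2 2 [⟨0, .virt α⟩, ⟨2, .cap⟩, ⟨1, .virt α⟩, ⟨0, .cup⟩]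
      [⟨2, .cap⟩, ⟨0, .virt α⟩, ⟨1, .virt α⟩, ⟨0, .cup⟩] :=
    (iso (.exchange (.virt α) .cap 0)).rewrite 0 0 [] [⟨1, .virt α⟩, ⟨0, .cup⟩]
      (.of_bottom rfl) (.of_bottom rfl) rfl rfl
  have e3 : Derivable S 2 2 [⟨2, .cap⟩, ⟨0, .virt α⟩, ⟨1, .virt α⟩, ⟨0, .cup⟩]
      [⟨2, .cap⟩, ⟨1, .cup⟩] :=
    hcup.rewrite 0 1 [⟨2, .cap⟩] [] (.of_bottom rfl) (.of_bottom rfl) rfl rfl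
  have e4 : Derivable S 2 2 [⟨2, .cap⟩, ⟨1, .cup⟩] [] :=
    (iso .zigzag_right).rewrite 1 0 [] [] (.of_bottom rfl) (.of_bottom rfl) rfl rfl
  exact ((e1.trans e2).trans e3).trans e4

theorem derivable_of_detour (hI : Isotopy ≤ S) (hD : Detour ≤ S) {o : Bool} {a b : ℕ}
    {l r : Strips T} (h : (V1 ⊔ V2 ⊔ CV3 o ⊔ MV3 : Moves T) a b l r) : Derivable S a b l r := by
  obtain ((⟨⟨α⟩⟩ | ⟨⟨α⟩⟩) | ⟨⟨α⟩⟩) | ⟨⟨α, β⟩⟩ := h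
  -- Across the empty tangle the detour only changes the loops on the strand.
  · exact .of_move (.of_bottom rfl) (.of_bottom rfl) (hD _ _ _ _
      (.mk α 0 0 [] _ [] (.of_bottom rfl) (.loop_right .nil) .nil))
  · exact V2.derivable hI hD α
  · exact .of_move (.of_bottom rfl) (.of_bottom rfl) (hD _ _ _ _
      (.mk α 2 2 [⟨0, .classical o⟩] _ _ (.of_bottom rfl) (alphaStrand_two α) (alphaStrand_two α)))
  · exact .of_move (.of_bottom rfl) (.of_bottom rfl) (hD _ _ _ _
      (.mk α 2 2 [⟨0, .virt β⟩] _ _ (.of_bottom rfl) (alphaStrand_two α) (alphaStrand_two α)))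

end Converse

end MultiVirtual

/-! ### Both equivalences -/

theorem theorem2p2 {T : Type*} (o : Bool) (D D' : MultiVirtual.Diagram T) :
    (MultiVirtual.Related (MultiVirtual.Isotopy ⊔ MultiVirtual.Detour) D D' ↔
      MultiVirtual.Related (MultiVirtual.Isotopy ⊔ (MultiVirtual.V1 ⊔ MultiVirtual.V2 ⊔
        MultiVirtual.CV3 o ⊔ MultiVirtual.MV3)) D D') ∧
    (MultiVirtual.Equivalent D D' ↔
      MultiVirtual.Related (MultiVirtual.Isotopy ⊔ MultiVirtual.Reidemeister ⊔
        (MultiVirtual.V1 ⊔ MultiVirtual.V2 ⊔ MultiVirtual.CV3 o ⊔ MultiVirtual.MV3)) D D') := by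
  refine ⟨⟨.of_derivable ?_, .of_derivable ?_⟩, ⟨.of_derivable ?_, .of_derivable ?_⟩⟩
  · rintro a b l r (h | h)
    · exact .of_isotopy le_sup_left h
    · exact h.derivable le_sup_left le_sup_right
  · rintro a b l r (h | h)
    · exact .of_isotopy le_sup_left h
    · exact MultiVirtual.derivable_of_detour le_sup_left le_sup_right h
  · rintro a b l r ((h | h) | h)
    · exact .of_isotopy (le_sup_left.trans le_sup_left) h
    · exact .of_move h.isTangle.1 h.isTangle.2 (.inl (.inr h))
    · exact h.derivable (le_sup_left.trans le_sup_left) le_sup_right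
  · rintro a b l r ((h | h) | h)
    · exact .of_isotopy (le_sup_left.trans le_sup_left) h
    · exact .of_move h.isTangle.1 h.isTangle.2 (.inl (.inr h))
    · exact MultiVirtual.derivable_of_detour (le_sup_left.trans le_sup_left) le_sup_right h
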